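/- Let $P\subset\mathbb{R}^2$ be a finite set of points. A point $p$ dominates a point $q\neq p$ if $x_p\ge x_q$ and $y_p\ge y_q$; the skyline of a set consists of its points that are not dominated by another point of the set. The anti-dominance query with parameters $(x,y)\in\mathbb{R}^2$ asks for the skyline of $P\cap\big((-\infty,x]\times(-\infty,y]\big)$; its output size, the number of points in this skyline, is denoted by $k$. A pointer machine structure for $P$ is a finite directed graph in which some nodes are designated as entry nodes and each node is either assigned one element of $P$ or is assigned none. A query is answered by a navigation of the graph that starts at entry nodes and in which every further accessed node is an out-neighbour of a node accessed before; for each point of the answer, some accessed node must be assigned this point (other nodes may be accessed too). The query time is the number of accesses, and the space of the structure is its number of nodes. Theorem. Let $\gamma$ and $C$ be real constants and let $b,e$ be natural numbers. There are a constant $c>0$ and an $N$, depending only on $\gamma,C,b,e$, such that for every $n\ge N$ there is a set $P$ of $n$ points in $\mathbb{R}^2$, no two of them with the same $x$-coordinate or the same $y$-coordinate, with the following property: every pointer machine structure for $P$ in which all out-degrees are at most $b$, and which answers every anti-dominance query on $P$ in time at most $C(\log^\gamma n+k)$ by a navigation that uses at most $e$ entry nodes as starting nodes, has space at least $c\,\dfrac{n\log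 n}{\log\log n}$. In other words, anti-dominance range skyline reporting with query time $O(\log^\gamma n+k)$, $\gamma=O(1)$, requires $\Omega(n\log n/\log\log n)$ space in the pointer machine model. -/

import Mathlib

namespace RangeSkyline

/-- A point `p` dominates a different point `q` if neither coordinate of `p` is smaller. -/
def Dominates (p q : ℝ × ℝ) : Prop :=
  p ≠ q ∧ q.1 ≤ p.1 ∧ q.2 ≤ p.2

/-- No two points have the same `x`-coordinate or the same `y`-coordinate. -/
def GeneralPosition (P : Finset (ℝ × ℝ)) : Prop :=
  Set.InjOn Prod.fst (P : Set (ℝ × ℝ)) ∧ Set.InjOn Prod.snd (P : Set (ℝ × ℝ))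

open Classical in
/-- The skyline: the points that are not dominated by any other point of the set. -/
noncomputable def skyline (P : Finset (ℝ × ℝ)) : Finset (ℝ × ℝ) :=
  {p ∈ P | ∀ q ∈ P, ¬ Dominates q p}

open Classical in
/-- The answer to the anti-dominance query with rectangle `(-∞, a] × (-∞, b]`: the skyline of the
points inside the rectangle. -/
noncomputable def antiDominanceAnswer (P : Finset (ℝ × ℝ)) (a b : ℝ) : Finset (ℝ × ℝ) :=
  skyline {p ∈ P | p ∈ Set.Iic a ×ˢ Set.Iic b}

/-- A pointer machine data structure with node set `V` that stores the point set `P`: a directed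
graph in which some nodes are entry nodes, and each node may be assigned an element of `P`. A node
with `point v = none` carries other information. -/
structure PointerStructure (P : Finset (ℝ × ℝ)) (V : Type*) where
  /-- The nodes that the pointers stored at a node lead to. -/
  next : V → Finset V
  /-- The entry nodes. -/
  entry : Set V
  /-- The element of `P` assigned to a node, if there is one. -/
  point : V → Option P

namespace PointerStructure

variable {P : Finset (ℝ × ℝ)} {V : Type*}

/-- `G.Run s l`: there is a navigation of `G` from the starting nodes `s` that accesses exactly the
nodes of `l`, one per step, the last accessed node first. Each step goes to a starting node or
follows a pointer out of a node accessed earlier; the number of steps is the length of `l`. -/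
inductive Run (G : PointerStructure P V) (s : Finset V) : List V → Prop
  | nil : Run G s []
  | start {v : V} {l : List V} : v ∈ s → Run G s l → Run G s (v :: l)
  | follow {u v : V} {l : List V} : u ∈ l → v ∈ G.next u → Run G s l → Run G s (v :: l)

/-- The set `A` of points can be reported in time `t`, using at most `e` of the entry nodes: a
navigation of at most `t` steps, started at at most `e` entry nodes, accesses for every point of `A`
a node that is assigned this point. It may access further nodes. -/
def ReportsIn (G : PointerStructure P V) (e : ℕ) (A : Finset (ℝ × ℝ)) (t : ℝ) : Prop :=
  ∃ (s : Finset V) (l : List V), (∀ v ∈ s, v ∈ G.entry) ∧ s.card ≤ e ∧ G.Run s l ∧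
    (l.length : ℝ) ≤ t ∧ ∀ p ∈ A, ∃ v ∈ l, (G.point v).map Subtype.val = some p

end PointerStructure

end RangeSkyline

/-! The accessed nodes of a navigation of `T` steps form a forest with at most `e` roots. Cutting it
at every `D`-th level leaves at most `T / D + e` trees for a suitable offset, so all but that many
reported nodes can be paired with another reported node of the same tree (`Run.exists_pairs`). Both
nodes of a pair are within `D` steps of a common node; with out-degrees at most `b`, only `|V| (b +
1) ^ (2 * D)` such pairs exist. If distinct answers share at most one point, they use disjoint sets
of pairs, so for constant `D` the space is at least of the order of the total answer size
(`mul_le_card_of_reportsIn`).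

The hard input consists of the points `(i, -rev i)`, where `i` has `r` digits in radix `w`. Varying
one digit and fixing the others gives `w` points on a descending staircase, which is exactly one
query answer (`antiDominanceAnswer_revSet`). Two of its points determine the group
(`insertDigit_pair_unique`). There are `r * w ^ (r - 1)` groups, of total size `r * w ^ r`. Taking
`w` at least about `log^γ n` lets the output size absorb the additive query cost, while `r` can
still be of order `log n / log log n` (`eventually_exists_radix`). -/

namespace RangeSkyline

/-! ### Navigations and the counting bound for reporting nearly disjoint sets. -/

namespace PointerStructure

variable {P : Finset (ℝ × ℝ)} {V : Type*}

/-- A navigation induces a forest on the accessed nodes, rooted at the starting nodes. -/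
theorem Run.exists_forest {G : PointerStructure P V} {s : Finset V} {l : List V}
    (h : G.Run s l) :
    ∃ (depth : V → ℕ) (par : V → V), ∀ v ∈ l, (depth v = 0 ∧ v ∈ s) ∨
      (par v ∈ l ∧ v ∈ G.next (par v) ∧ depth v = depth (par v) + 1) := by
  classical
  induction h with
  | nil => exact ⟨fun _ => 0, id, by simp⟩
  | @start v l hv _ ih =>
    obtain ⟨depth, par, H⟩ := ih
    -- A revisited node keeps its old depth and parent; changing them could invalidate the depths of
    -- its children.
    by_cases hvl : v ∈ l
    · refine ⟨depth, par, fun w hw => ?_⟩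
      have hw' : w ∈ l := by
        rcases List.mem_cons.1 hw with rfl | hw
        exacts [hvl, hw]
      rcases H w hw' with h | ⟨h1, h2⟩
      exacts [Or.inl h, Or.inr ⟨List.mem_cons_of_mem _ h1, h2⟩]
    · refine ⟨Function.update depth v 0, par, fun w hw => ?_⟩
      by_cases hwv : w = v
      · subst hwv
        exact Or.inl ⟨by simp, hv⟩
      · have hw' : w ∈ l := (List.mem_cons.1 hw).resolve_left hwv
        rcases H w hw' with h | ⟨h1, h2, h3⟩
        · exact Or.inl (by simpa [hwv] using h)
        · have hne : par w ≠ v := fun h => hvl (h ▸ h1)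
          exact Or.inr ⟨List.mem_cons_of_mem _ h1, h2, by simpa [hwv, hne] using h3⟩
  | @follow u v l hu hv _ ih =>
    obtain ⟨depth, par, H⟩ := ih
    by_cases hvl : v ∈ l
    · refine ⟨depth, par, fun w hw => ?_⟩
      have hw' : w ∈ l := by
        rcases List.mem_cons.1 hw with rfl | hw
        exacts [hvl, hw]
      rcases H w hw' with h | ⟨h1, h2⟩
      exacts [Or.inl h, Or.inr ⟨List.mem_cons_of_mem _ h1, h2⟩]
    · refine ⟨Function.update depth v (depth u + 1), Function.update par v u, fun w hw => ?_⟩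
      by_cases hwv : w = v
      · subst hwv
        have hne : u ≠ w := fun h => hvl (h ▸ hu)
        exact Or.inr ⟨by simp [hu], by simpa using hv, by simp [hne]⟩
      · have hw' : w ∈ l := (List.mem_cons.1 hw).resolve_left hwv
        rcases H w hw' with h | ⟨h1, h2, h3⟩
        · exact Or.inl (by simpa [hwv] using h)
        · have hne : par w ≠ v := fun h => hvl (h ▸ h1)
          exact Or.inr ⟨by simp [hwv, h1], by simpa [hwv] using h2, by simpa [hwv, hne] using h3⟩

open Classical in
/-- The nodes that are reached from a node by following at most `k` pointers. -/
noncomputable def reach (G : PointerStructure P V) (w : V) : ℕ → Finset V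
  | 0 => {w}
  | k + 1 => (G.reach w k).biUnion fun v => insert v (G.next v)

theorem reach_mono (G : PointerStructure P V) (w : V) : Monotone (G.reach w) := by
  classical
  refine monotone_nat_of_le_succ fun k v hv => ?_
  simp only [reach, Finset.mem_biUnion]
  exact ⟨v, hv, Finset.mem_insert_self _ _⟩

theorem card_reach_le {G : PointerStructure P V} {b : ℕ} (hb : ∀ v, (G.next v).card ≤ b) (w : V)
    (k : ℕ) : (G.reach w k).card ≤ (b + 1) ^ k := by
  classical
  induction k with
  | zero => simp [reach]
  | succ k ih =>
    calc (G.reach w (k + 1)).card ≤ (G.reach w k).card * (b + 1) :=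
          Finset.card_biUnion_le_card_mul _ _ _ fun v _ =>
            (Finset.card_insert_le _ _).trans (Nat.add_le_add_right (hb v) 1)
      _ ≤ (b + 1) ^ (k + 1) := by rw [pow_succ]; exact Nat.mul_le_mul_right _ ih

open Classical in
/-- The pairs of nodes that are both reached from a common node in at most `k` steps. -/
noncomputable def closePairs [Fintype V] (G : PointerStructure P V) (k : ℕ) : Finset (V × V) :=
  Finset.univ.biUnion fun w => G.reach w k ×ˢ G.reach w k

theorem card_closePairs_le [Fintype V] {G : PointerStructure P V} {b : ℕ}
    (hb : ∀ v, (G.next v).card ≤ b) (k : ℕ) :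
    (G.closePairs k).card ≤ Fintype.card V * ((b + 1) ^ k) ^ 2 := by
  classical
  refine Finset.card_biUnion_le_card_mul _ _ _ fun w _ => ?_
  rw [Finset.card_product, sq]
  exact Nat.mul_le_mul (card_reach_le hb w k) (card_reach_le hb w k)

/-- Climbing at most `depth v` levels never passes a root. Since `reach` grows at its far end,
prepending a pointer at the near end needs the auxiliary induction `reach_succ`. -/
theorem iterate_parent {G : PointerStructure P V} {s : Finset V} {l : List V} {depth : V → ℕ}
    {par : V → V} (H : ∀ v ∈ l, (depth v = 0 ∧ v ∈ s) ∨
      (par v ∈ l ∧ v ∈ G.next (par v) ∧ depth v = depth (par v) + 1)) {v : V} (hv : v ∈ l)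
    {k : ℕ} (hk : k ≤ depth v) :
    par^[k] v ∈ l ∧ depth (par^[k] v) + k = depth v ∧ v ∈ G.reach (par^[k] v) k := by
  classical
  have reach_succ : ∀ (k : ℕ) (w x y : V), x ∈ G.next w → y ∈ G.reach x k →
      y ∈ G.reach w (k + 1) := by
    intro k
    induction k with
    | zero =>
      intro w x y hx hy
      simp only [reach, Finset.mem_singleton] at hy
      subst hy
      simp [reach, hx]
    | succ k ih =>
      intro w x y hx hy
      rw [reach, Finset.mem_biUnion] at hy ⊢
      obtain ⟨z, hz, hyz⟩ := hy
      exact ⟨z, ih w x z hx hz, hyz⟩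
  induction k with
  | zero => simp [reach, hv]
  | succ k ih =>
    obtain ⟨h1, h2, h3⟩ := ih (by omega)
    rw [Function.iterate_succ_apply']
    rcases H _ h1 with ⟨h, -⟩ | ⟨h4, h5, h6⟩
    · omega
    · exact ⟨h4, by omega, reach_succ k _ _ _ h5 h3⟩

/-- Cutting the forest of a navigation at every `D`-th level leaves few trees, so that most of the
accessed nodes are close to another one of a given set. -/
theorem Run.exists_pairs [Fintype V] {G : PointerStructure P V} {s : Finset V} {l : List V}
    (h : G.Run s l) {D : ℕ} (hD : 0 < D) (U : Finset V) (hU : ∀ v ∈ U, v ∈ l) :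
    ∃ A : Finset (V × V), A ⊆ G.closePairs D ∧ (∀ x ∈ A, x.1 ∈ U ∧ x.2 ∈ U ∧ x.1 ≠ x.2) ∧
      D * U.card ≤ D * A.card + l.length + D * s.card := by
  classical
  obtain ⟨depth, par, H⟩ := h.exists_forest
  -- Pigeonhole over the `D` residue classes of the depth.
  obtain ⟨r, hr, hcard⟩ : ∃ r < D, D * {v ∈ l.toFinset | depth v % D = r}.card ≤ l.length := by
    by_contra! hcon
    have hsum : ∑ r ∈ Finset.range D, {v ∈ l.toFinset | depth v % D = r}.card
        = l.toFinset.card :=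
      (Finset.card_eq_sum_card_fiberwise
        fun v _ => Finset.mem_coe.2 (Finset.mem_range.2 (Nat.mod_lt _ hD))).symm
    have h1 : ∑ _r ∈ Finset.range D, l.length <
        ∑ r ∈ Finset.range D, D * {v ∈ l.toFinset | depth v % D = r}.card :=
      Finset.sum_lt_sum_of_nonempty ⟨0, Finset.mem_range.2 hD⟩
        fun r hr => hcon r (Finset.mem_range.1 hr)
    rw [← Finset.mul_sum, hsum, Finset.sum_const, Finset.card_range, smul_eq_mul] at h1
    exact absurd (Nat.lt_of_mul_lt_mul_left h1) (not_lt.2 l.toFinset_card_le)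
  set R : Finset V := {v ∈ l.toFinset | depth v % D = r} with hR
  -- The distance up to the nearest ancestor at a depth congruent to `r`, capped at the root; adding
  -- `D - r` avoids truncated subtraction.
  let k : V → ℕ := fun v => min (depth v) ((depth v + (D - r)) % D)
  have hkD : ∀ v, k v ≤ D := fun v => (min_le_right _ _).trans (Nat.mod_lt _ hD).le
  let f : V → V := fun v => par^[k v] v
  have hf : ∀ v ∈ l, f v ∈ R ∪ s ∧ v ∈ G.reach (f v) D := by
    intro v hv
    obtain ⟨h1, h2, h3⟩ := iterate_parent H hv (min_le_left _ _ : k v ≤ depth v)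
    refine ⟨?_, G.reach_mono _ (hkD v) h3⟩
    rw [Finset.mem_union]
    rcases Nat.eq_zero_or_pos (depth (f v)) with h0 | h0
    · rcases H _ h1 with ⟨-, h⟩ | ⟨-, -, h⟩
      · exact Or.inr h
      · change depth (f v) = _ at h
        omega
    · refine Or.inl (Finset.mem_filter.2 ⟨List.mem_toFinset.2 h1, ?_⟩)
      change depth (f v) + k v = depth v at h2
      have hk : k v = (depth v + (D - r)) % D := by
        have : k v = min (depth v) ((depth v + (D - r)) % D) := rfl
        omega
      have hdm := Nat.div_add_mod (depth v + (D - r)) D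
      rw [← hk] at hdm
      set q := (depth v + (D - r)) / D
      have h4 : depth (f v) + D = r + D * q := by omega
      have h5 := congrArg (· % D) h4
      simpa [Nat.mod_eq_of_lt hr] using h5
  -- One representative in `U` is chosen per tree; every other node of `U` is paired with the
  -- representative of its tree.
  have hrep : ∀ w, ∃ u, (∃ u ∈ U, f u = w) → u ∈ U ∧ f u = w := by
    intro w
    by_cases hw : ∃ u ∈ U, f u = w
    · obtain ⟨u, hu⟩ := hw
      exact ⟨u, fun _ => hu⟩
    · exact ⟨w, fun h => absurd h hw⟩
  choose rep hrep using hrep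
  have hrep' : ∀ v ∈ U, rep (f v) ∈ U ∧ f (rep (f v)) = f v := fun v hv => hrep _ ⟨v, hv, rfl⟩
  refine ⟨{v ∈ U | rep (f v) ≠ v}.image fun v => (rep (f v), v), ?_, ?_, ?_⟩
  · intro x hx
    obtain ⟨v, hv, rfl⟩ := Finset.mem_image.1 hx
    have hvU := (Finset.mem_filter.1 hv).1
    obtain ⟨h1, h2⟩ := hrep' v hvU
    refine Finset.mem_biUnion.2 ⟨f v, Finset.mem_univ _, Finset.mem_product.2 ⟨?_, ?_⟩⟩
    · have := (hf _ (hU _ h1)).2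
      rwa [h2] at this
    · exact (hf _ (hU _ hvU)).2
  · intro x hx
    obtain ⟨v, hv, rfl⟩ := Finset.mem_image.1 hx
    have hvU := (Finset.mem_filter.1 hv).1
    exact ⟨(hrep' v hvU).1, hvU, (Finset.mem_filter.1 hv).2⟩
  · rw [Finset.card_image_of_injective _ fun a b hab => (Prod.ext_iff.1 hab).2]
    have hsplit := Finset.card_filter_add_card_filter_not (s := U) fun v => rep (f v) = v
    have hle : {v ∈ U | rep (f v) = v}.card ≤ R.card + s.card := by
      refine (Finset.card_le_card_of_injOn f ?_ ?_).trans (Finset.card_union_le R s)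
      · intro v hv
        exact (hf v (hU v (Finset.mem_filter.1 hv).1)).1
      · intro u hu v hv huv
        rw [← (Finset.mem_filter.1 hu).2, ← (Finset.mem_filter.1 hv).2, huv]
    have := Nat.mul_le_mul_left D hle
    rw [← hsplit]
    simp only [mul_add] at this ⊢
    simp only [ne_eq]
    omega

/-- The space lower bound for reporting sets that pairwise share at most one point. -/
theorem mul_le_card_of_reportsIn [Fintype V] {G : PointerStructure P V} {b e D : ℕ}
    (hb : ∀ v, (G.next v).card ≤ b) (hD : 0 < D) {ι : Type*} (Q : Finset ι)
    (A : ι → Finset (ℝ × ℝ)) {m t : ℝ} (hm : ∀ i ∈ Q, m ≤ (A i).card)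
    (hA : ∀ i ∈ Q, ∀ j ∈ Q, ∀ p ∈ A i ∩ A j, ∀ q ∈ A i ∩ A j, p ≠ q → i = j)
    (ht : ∀ i ∈ Q, G.ReportsIn e (A i) t) :
    Q.card * (m - t / D - e) ≤ Fintype.card V * (((b : ℝ) + 1) ^ D) ^ 2 := by
  classical
  have key : ∀ i ∈ Q, ∃ B : Finset (V × V), B ⊆ G.closePairs D ∧
      (∀ x ∈ B, ∃ p ∈ A i, ∃ q ∈ A i, p ≠ q ∧ (G.point x.1).map Subtype.val = some p ∧
        (G.point x.2).map Subtype.val = some q) ∧ m - t / D - e ≤ B.card := by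
    intro i hi
    obtain ⟨s, l, -, hs, hrun, hl, hp⟩ := ht i hi
    -- The function `node` chosen below needs a default value in `V`.
    rcases isEmpty_or_nonempty V with hV | hV
    · have h1 : (A i).card = 0 :=
        Finset.card_eq_zero.2 (Finset.eq_empty_of_forall_notMem fun p hpA => hV.elim (hp p hpA).choose)
      have h2 := hm i hi
      have h3 : 0 ≤ t / D := div_nonneg ((Nat.cast_nonneg _).trans hl) D.cast_nonneg
      rw [h1, Nat.cast_zero] at h2
      have h4 : (0 : ℝ) ≤ e := e.cast_nonneg
      exact ⟨∅, by simp, by simp, by simp; linarith⟩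
    choose! node hnode using hp
    have hinj : Set.InjOn node (A i) := fun p hp q hq hpq =>
      Option.some_injective _ ((hnode p hp).2.symm.trans (hpq ▸ (hnode q hq).2))
    obtain ⟨B, hB, hB', hcard⟩ := hrun.exists_pairs hD ((A i).image node) (by
      intro v hv
      obtain ⟨p, hp, rfl⟩ := Finset.mem_image.1 hv
      exact (hnode p hp).1)
    refine ⟨B, hB, fun x hx => ?_, ?_⟩
    · obtain ⟨h1, h2, h3⟩ := hB' x hx
      obtain ⟨p, hp, hp'⟩ := Finset.mem_image.1 h1
      obtain ⟨q, hq, hq'⟩ := Finset.mem_image.1 h2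
      refine ⟨p, hp, q, hq, ?_, hp' ▸ (hnode p hp).2, hq' ▸ (hnode q hq).2⟩
      rintro rfl
      exact h3 (hp'.symm.trans hq')
    · rw [Finset.card_image_of_injOn hinj] at hcard
      have hcard' : (D : ℝ) * (A i).card ≤ D * B.card + l.length + D * s.card := by
        exact_mod_cast hcard
      have hD' : (0 : ℝ) < D := by exact_mod_cast hD
      have hs' : (s.card : ℝ) ≤ e := by exact_mod_cast hs
      have h1 : (D : ℝ) * (t / D) = t := by field_simp
      have h2 := hm i hi
      refine le_of_mul_le_mul_left ?_ hD'
      rw [mul_sub, mul_sub, h1]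
      have h3 := mul_le_mul_of_nonneg_left h2 hD'.le
      have h4 := mul_le_mul_of_nonneg_left hs' hD'.le
      linarith
  choose! B hB hBp hBc using key
  have hdisj : (Q : Set ι).PairwiseDisjoint B := by
    intro i hi j hj hij
    refine Finset.disjoint_left.2 fun x hxi hxj => hij ?_
    obtain ⟨p, hp, q, hq, hpq, h1, h2⟩ := hBp i hi x hxi
    obtain ⟨p', hp', q', hq', -, h1', h2'⟩ := hBp j hj x hxj
    obtain rfl : p = p' := Option.some_injective _ (h1.symm.trans h1')
    obtain rfl : q = q' := Option.some_injective _ (h2.symm.trans h2')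
    exact hA i hi j hj p (Finset.mem_inter.2 ⟨hp, hp'⟩) q (Finset.mem_inter.2 ⟨hq, hq'⟩) hpq
  calc Q.card * (m - t / D - e) = ∑ _i ∈ Q, (m - t / D - e) := by rw [Finset.sum_const, nsmul_eq_mul]
    _ ≤ ∑ i ∈ Q, ((B i).card : ℝ) := Finset.sum_le_sum hBc
    _ = ((Q.biUnion B).card : ℝ) := by rw [Finset.card_biUnion hdisj]; push_cast; rfl
    _ ≤ ((G.closePairs D).card : ℝ) := by
      exact_mod_cast Finset.card_le_card (Finset.biUnion_subset.2 hB)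
    _ ≤ Fintype.card V * (((b : ℝ) + 1) ^ D) ^ 2 := by
      exact_mod_cast card_closePairs_le hb D

end PointerStructure

/-! ### Arithmetic of digit reversal. -/

/-- Reversal of the `k` lowest digits in radix `w`. -/
def digitRev (w : ℕ) : ℕ → ℕ → ℕ
  | 0, _ => 0
  | k + 1, i => i % w * w ^ k + digitRev w k (i / w)

theorem digitRev_lt {w : ℕ} (hw : 0 < w) (k i : ℕ) : digitRev w k i < w ^ k := by
  induction k generalizing i with
  | zero => simp [digitRev]
  | succ k ih =>
    have h1 : i % w + 1 ≤ w := Nat.mod_lt _ hw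
    have h2 := ih (i / w)
    have h3 := Nat.mul_le_mul_right (w ^ k) h1
    rw [add_mul, one_mul] at h3
    rw [digitRev, pow_succ, mul_comm (w ^ k) w]
    omega

theorem eq_and_eq_of_mul_add_eq {m a a' r r' : ℕ} (hr : r < m) (hr' : r' < m)
    (h : a * m + r = a' * m + r') : a = a' ∧ r = r' := by
  have hm : 0 < m := by omega
  have h1 := congrArg (· / m) h
  have h2 := congrArg (· % m) h
  simp only [mul_comm _ m, Nat.mul_add_div hm, Nat.div_eq_of_lt hr, Nat.div_eq_of_lt hr',
    add_zero, Nat.mul_add_mod, Nat.mod_eq_of_lt hr, Nat.mod_eq_of_lt hr'] at h1 h2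
  exact ⟨h1, h2⟩

theorem digitRev_inj {w : ℕ} (hw : 0 < w) {k i j : ℕ} (hi : i < w ^ k) (hj : j < w ^ k)
    (h : digitRev w k i = digitRev w k j) : i = j := by
  induction k generalizing i j with
  | zero => simp only [pow_zero, Nat.lt_one_iff] at hi hj; omega
  | succ k ih =>
    rw [digitRev, digitRev] at h
    obtain ⟨h1, h2⟩ := eq_and_eq_of_mul_add_eq (digitRev_lt hw k _) (digitRev_lt hw k _) h
    rw [pow_succ] at hi hj
    have h3 := ih (Nat.div_lt_of_lt_mul (by rwa [mul_comm] at hi))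
      (Nat.div_lt_of_lt_mul (by rwa [mul_comm] at hj)) h2
    rw [← Nat.div_add_mod i w, ← Nat.div_add_mod j w, h1, h3]

/-- Each block of digits is reversed by itself and the two blocks trade places. -/
theorem digitRev_add {w : ℕ} (hw : 0 < w) (j k h l : ℕ) (hl : l < w ^ j) :
    digitRev w (j + k) (h * w ^ j + l) = digitRev w j l * w ^ k + digitRev w k h := by
  induction j generalizing l with
  | zero =>
    obtain rfl : l = 0 := by simpa using hl
    simp [digitRev]
  | succ j ih =>
    have h1 : h * w ^ (j + 1) + l = w * (h * w ^ j) + l := by ring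
    have h2 : l / w < w ^ j := Nat.div_lt_of_lt_mul (by rwa [pow_succ, mul_comm] at hl)
    rw [show j + 1 + k = (j + k) + 1 by omega, digitRev, digitRev, h1, Nat.mul_add_mod,
      Nat.mul_add_div hw, ih _ h2]
    ring

theorem digitRev_one {w d : ℕ} (hd : d < w) : digitRev w 1 d = d := by
  simp [digitRev, Nat.mod_eq_of_lt hd]

theorem digitRev_split {w : ℕ} (hw : 0 < w) (j k : ℕ) {h d l : ℕ} (hd : d < w) (hl : l < w ^ j) :
    digitRev w (j + (1 + k)) ((h * w + d) * w ^ j + l)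
      = digitRev w j l * w ^ (1 + k) + (d * w ^ k + digitRev w k h) := by
  rw [digitRev_add hw _ _ _ _ hl]
  have := digitRev_add hw 1 k h d (by simpa using hd)
  rw [pow_one, digitRev_one hd] at this
  rw [this]

/-- The number whose digit at position `j` is `d` and whose other digits are those of `m`. -/
def insertDigit (w j m d : ℕ) : ℕ := (m / w ^ j * w + d) * w ^ j + m % w ^ j

theorem insertDigit_lt {w : ℕ} {j k m d : ℕ} (hd : d < w) (hm : m < w ^ (j + k)) :
    insertDigit w j m d < w ^ (j + (1 + k)) := by
  have hw : 0 < w := by omega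
  have hj : 0 < w ^ j := pow_pos hw j
  have h1 : m / w ^ j + 1 ≤ w ^ k := Nat.div_lt_of_lt_mul (by rwa [pow_add] at hm)
  have h2 : m % w ^ j < w ^ j := Nat.mod_lt _ hj
  have h3 : m / w ^ j * w + d + 1 ≤ w ^ (1 + k) := by
    have := Nat.mul_le_mul_right w h1
    rw [add_mul, one_mul] at this
    rw [add_comm 1 k, pow_succ]
    omega
  have h4 := Nat.mul_le_mul_right (w ^ j) h3
  rw [add_mul, one_mul] at h4
  rw [pow_add, insertDigit, mul_comm (w ^ j)]
  omega

theorem digitRev_insertDigit {w : ℕ} (j k m : ℕ) {d : ℕ} (hd : d < w) :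
    digitRev w (j + (1 + k)) (insertDigit w j m d)
      = digitRev w j (m % w ^ j) * w ^ (1 + k) + (d * w ^ k + digitRev w k (m / w ^ j)) :=
  digitRev_split (by omega) _ _ hd (Nat.mod_lt _ (pow_pos (by omega) j))

theorem insertDigit_strictMono {w : ℕ} (hw : 0 < w) (j m : ℕ) : StrictMono (insertDigit w j m) := by
  intro d d' h
  have hj : 0 < w ^ j := pow_pos hw j
  simp only [insertDigit]
  gcongr

/-- Two numbers that differ in exactly one digit determine its position and the other digits. -/
theorem insertDigit_pair_unique {w j j' m m' a b a' b' : ℕ} (ha : a < w) (hb : b < w)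
    (ha' : a' < w) (hb' : b' < w) (hab : a ≠ b) (h1 : insertDigit w j m a = insertDigit w j' m' a')
    (h2 : insertDigit w j m b = insertDigit w j' m' b') : j = j' ∧ m = m' := by
  have hw : 0 < w := by omega
  have diff : ∀ j m a b, (insertDigit w j m a : ℤ) - insertDigit w j m b = (a - b) * w ^ j := by
    intro j m a b
    simp only [insertDigit]
    push_cast
    ring
  -- If `j < j'`, the difference `(a - b) * w ^ j` would be a multiple of `w ^ (j + 1)`, although `0
  -- < |a - b| < w`.
  have hne : ∀ {j j' m m' a b a' b'}, a < w → b < w → a ≠ b →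
      insertDigit w j m a = insertDigit w j' m' a' →
      insertDigit w j m b = insertDigit w j' m' b' → ¬ j < j' := by
    intro j j' m m' a b a' b' ha hb hab h1 h2 hj
    have h3 := diff j m a b
    rw [h1, h2, diff] at h3
    obtain ⟨t, rfl⟩ := Nat.exists_eq_add_of_lt hj
    have h4 : (w : ℤ) ^ j ≠ 0 := pow_ne_zero _ (by exact_mod_cast hw.ne')
    have h5 : (w : ℤ) ∣ (a : ℤ) - b := by
      refine ⟨(a' - b') * w ^ t, mul_right_cancel₀ h4 ?_⟩
      rw [← h3]
      ring
    have h6 := Int.eq_zero_of_abs_lt_dvd h5 (by rw [abs_lt]; omega)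
    omega
  have hab' : a' ≠ b' := by
    rintro rfl
    exact hab ((insertDigit_strictMono hw j m).injective (h1.trans h2.symm))
  have hj : j = j' := le_antisymm (not_lt.1 (hne ha' hb' hab' h1.symm h2.symm))
    (not_lt.1 (hne ha hb hab h1 h2))
  subst hj
  have hj0 : 0 < w ^ j := pow_pos hw j
  obtain ⟨h3, h4⟩ := eq_and_eq_of_mul_add_eq (Nat.mod_lt _ hj0) (Nat.mod_lt _ hj0) h1
  obtain ⟨h5, -⟩ := eq_and_eq_of_mul_add_eq ha ha' h3
  exact ⟨rfl, by rw [← Nat.div_add_mod m (w ^ j), ← Nat.div_add_mod m' (w ^ j), h4, h5]⟩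

/-- Every number in the range between the least and the largest digit is dominated by a number
obtained by inserting a digit. -/
theorem exists_insertDigit_dominates {w j k m q : ℕ} (hw : 0 < w)
    (h1 : q ≤ insertDigit w j m (w - 1))
    (h2 : digitRev w (j + (1 + k)) (insertDigit w j m 0) ≤ digitRev w (j + (1 + k)) q) :
    ∃ d < w, q ≤ insertDigit w j m d ∧
      digitRev w (j + (1 + k)) (insertDigit w j m d) ≤ digitRev w (j + (1 + k)) q := by
  have hj : 0 < w ^ j := pow_pos hw j
  obtain ⟨h', d', l', hd', hl', rfl⟩ :
      ∃ h' d' l', d' < w ∧ l' < w ^ j ∧ q = (h' * w + d') * w ^ j + l' :=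
    ⟨q / w ^ j / w, q / w ^ j % w, q % w ^ j, Nat.mod_lt _ hw, Nat.mod_lt _ hj, by
      rw [mul_comm _ w, Nat.div_add_mod, mul_comm, Nat.div_add_mod]⟩
  have hl : m % w ^ j < w ^ j := Nat.mod_lt _ hj
  have bound : ∀ {d h : ℕ}, d < w → d * w ^ k + digitRev w k h < w ^ (1 + k) := by
    intro d h hd
    have h3 := Nat.mul_le_mul_right (w ^ k) (show d + 1 ≤ w from hd)
    have h4 := digitRev_lt hw k h
    rw [add_mul, one_mul] at h3
    rw [pow_add, pow_one]
    omega
  have high : ∀ {x y r s t : ℕ}, x < y → r < t → x * t + r ≤ y * t + s := by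
    intro x y r s t hxy hr
    have := Nat.mul_le_mul_right t (show x + 1 ≤ y from hxy)
    rw [add_mul, one_mul] at this
    omega
  rw [digitRev_split hw j k hd' hl'] at h2 ⊢
  rw [digitRev_insertDigit j k m hw] at h2
  -- The digits below position `j` lead in the reversal, so they are compared first. If they agree,
  -- `h1` bounds the upper digits of `q`. When these are strictly smaller, the digit `d' - 1` works,
  -- or `0` if `d' = 0`.
  rcases lt_trichotomy (digitRev w j (m % w ^ j)) (digitRev w j l') with hlt | heq | hgt
  · refine ⟨w - 1, by omega, h1, ?_⟩
    rw [digitRev_insertDigit j k m (by omega)]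
    exact high hlt (bound (by omega))
  · have hll : m % w ^ j = l' := digitRev_inj hw hl hl' heq
    subst hll
    have h3 : h' ≤ m / w ^ j := by
      by_contra! hcon
      have h4 : m / w ^ j * w + (w - 1) < h' * w + d' := by
        have := Nat.mul_le_mul_right w (show m / w ^ j + 1 ≤ h' from hcon)
        rw [add_mul, one_mul] at this
        omega
      have h5 := Nat.mul_lt_mul_of_pos_right h4 hj
      rw [insertDigit] at h1
      omega
    rcases h3.eq_or_lt with h3 | h3
    · subst h3
      exact ⟨d', hd', le_rfl, by rw [digitRev_insertDigit j k m hd']⟩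
    · have h4 : ∀ d, (h' * w + d') * w ^ j + m % w ^ j ≤ insertDigit w j m d := by
        intro d
        rw [insertDigit]
        refine Nat.add_le_add_right (Nat.mul_le_mul_right _ ?_) _
        have := Nat.mul_le_mul_right w (show h' + 1 ≤ m / w ^ j from h3)
        rw [add_mul, one_mul] at this
        omega
      rcases Nat.eq_zero_or_pos d' with h0 | h0
      · subst h0
        exact ⟨0, hw, h4 0, by rw [digitRev_insertDigit j k m hw]; omega⟩
      · refine ⟨d' - 1, by omega, h4 _, ?_⟩
        rw [digitRev_insertDigit j k m (by omega)]
        exact Nat.add_le_add_left (high (Nat.sub_lt h0 one_pos) (digitRev_lt hw k _)) _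
  · have h3 : digitRev w j l' * w ^ (1 + k) + (d' * w ^ k + digitRev w k h') <
        digitRev w j (m % w ^ j) * w ^ (1 + k) := by
      have := Nat.mul_le_mul_right (w ^ (1 + k)) (show digitRev w j l' + 1 ≤ _ from hgt)
      rw [add_mul, one_mul] at this
      have := bound (h := h') hd'
      omega
    omega

/-! ### The hard point set and its queries. -/

/-- The point with `x`-coordinate `i` of the mirrored digit reversal set, for `i < w ^ r`. For larger
`i` it is a point to the right of all of these. -/
noncomputable def revPoint (w r i : ℕ) : ℝ × ℝ :=
  (i, if i < w ^ r then -(digitRev w r i : ℝ) else i)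

theorem revPoint_injective (w r : ℕ) : Function.Injective (revPoint w r) := fun i j h => by
  simpa [revPoint] using (Prod.ext_iff.1 h).1

/-- The mirrored digit reversal set with `w ^ r` points, padded to `n` points. -/
noncomputable def revSet (w r n : ℕ) : Finset (ℝ × ℝ) :=
  (Finset.range n).map ⟨revPoint w r, revPoint_injective w r⟩

theorem mem_revSet {w r n : ℕ} {p : ℝ × ℝ} : p ∈ revSet w r n ↔ ∃ i < n, revPoint w r i = p := by
  simp [revSet]

theorem card_revSet (w r n : ℕ) : (revSet w r n).card = n := by
  simp [revSet]

theorem generalPosition_revSet {w : ℕ} (hw : 0 < w) (r n : ℕ) :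
    GeneralPosition (revSet w r n) := by
  have hpos : 0 < w ^ r := pow_pos hw r
  have mixed : ∀ {i j : ℕ}, ¬ j < w ^ r → -(digitRev w r i : ℝ) ≠ j := by
    intro i j hj h
    have h1 : (0 : ℝ) < j := by exact_mod_cast (by omega : 0 < j)
    have h2 : (0 : ℝ) ≤ digitRev w r i := Nat.cast_nonneg _
    linarith
  constructor
  · intro p hp q hq h
    obtain ⟨i, -, rfl⟩ := mem_revSet.1 hp
    obtain ⟨j, -, rfl⟩ := mem_revSet.1 hq
    rw [show i = j by simpa [revPoint] using h]
  · intro p hp q hq h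
    obtain ⟨i, -, rfl⟩ := mem_revSet.1 hp
    obtain ⟨j, -, rfl⟩ := mem_revSet.1 hq
    congr 1
    simp only [revPoint] at h
    split_ifs at h with hi hj hj
    · exact digitRev_inj hw hi hj (by exact_mod_cast neg_injective h)
    · exact absurd h (mixed hj)
    · exact absurd h.symm (mixed hi)
    · exact_mod_cast h

/-- The points of the digit reversal set whose `x`-coordinates arise from `m` by inserting a digit
at position `j`. -/
noncomputable def digitGroup (w r j m : ℕ) : Finset (ℝ × ℝ) :=
  (Finset.range w).image fun d => revPoint w r (insertDigit w j m d)

theorem card_digitGroup {w : ℕ} (hw : 0 < w) (r j m : ℕ) : (digitGroup w r j m).card = w := by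
  exact (Finset.card_image_of_injective _ ((revPoint_injective w r).comp
    (insertDigit_strictMono hw j m).injective)).trans (Finset.card_range w)

theorem digitGroup_pair_unique {w r j j' m m' : ℕ} {p q : ℝ × ℝ}
    (hp : p ∈ digitGroup w r j m ∩ digitGroup w r j' m')
    (hq : q ∈ digitGroup w r j m ∩ digitGroup w r j' m') (hpq : p ≠ q) : j = j' ∧ m = m' := by
  simp only [digitGroup, Finset.mem_inter, Finset.mem_image, Finset.mem_range] at hp hq
  obtain ⟨⟨a, ha, hap⟩, a', ha', hap'⟩ := hp
  obtain ⟨⟨b, hb, hbq⟩, b', hb', hbq'⟩ := hq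
  refine insertDigit_pair_unique ha hb ha' hb' ?_
    (revPoint_injective w r (hap.trans hap'.symm)) (revPoint_injective w r (hbq.trans hbq'.symm))
  rintro rfl
  exact hpq (hap.symm.trans hbq)

theorem Dominates.trans {p q r : ℝ × ℝ} (hpq : Dominates p q) (hqr : Dominates q r) :
    Dominates p r := by
  refine ⟨?_, hqr.2.1.trans hpq.2.1, hqr.2.2.trans hpq.2.2⟩
  rintro rfl
  exact hpq.1 (Prod.ext (le_antisymm hqr.2.1 hpq.2.1) (le_antisymm hqr.2.2 hpq.2.2))

/-- By transitivity, a point outside `A` dominating a point of `A` would give a domination inside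
`A`. -/
theorem skyline_eq_of_antichain {S A : Finset (ℝ × ℝ)} (hAS : A ⊆ S)
    (hA : ∀ p ∈ A, ∀ q ∈ A, ¬ Dominates p q) (hS : ∀ q ∈ S, q ∉ A → ∃ p ∈ A, Dominates p q) :
    skyline S = A := by
  classical
  ext p
  simp only [skyline, Finset.mem_filter]
  constructor
  · rintro ⟨hp, h⟩
    by_contra hpA
    obtain ⟨q, hq, hqp⟩ := hS p hp hpA
    exact h q (hAS hq) hqp
  · refine fun hp => ⟨hAS hp, fun q hq hqp => ?_⟩
    by_cases hqA : q ∈ A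
    · exact hA q hqA p hp hqp
    · obtain ⟨x, hx, hxq⟩ := hS q hq hqA
      exact hA x hx p hp (hxq.trans hqp)

/-- Every digit group is the answer to an anti-dominance query. -/
theorem antiDominanceAnswer_revSet {w j k m n : ℕ} (hw : 0 < w) (hm : m < w ^ (j + k))
    (hn : w ^ (j + (1 + k)) ≤ n) :
    antiDominanceAnswer (revSet w (j + (1 + k)) n) (insertDigit w j m (w - 1))
      (-(digitRev w (j + (1 + k)) (insertDigit w j m 0) : ℝ)) =
        digitGroup w (j + (1 + k)) j m := by
  classical
  have hlt : ∀ {d}, d < w → insertDigit w j m d < w ^ (j + (1 + k)) := fun hd =>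
    insertDigit_lt hd hm
  have hpt : ∀ {i}, i < w ^ (j + (1 + k)) →
      revPoint w (j + (1 + k)) i = ((i : ℝ), -(digitRev w (j + (1 + k)) i : ℝ)) := by
    intro i hi
    simp [revPoint, hi]
  have hmono : ∀ {d d'}, d < w → d' < w → d < d' →
      digitRev w (j + (1 + k)) (insertDigit w j m d) <
        digitRev w (j + (1 + k)) (insertDigit w j m d') := by
    intro d d' hd hd' hdd
    rw [digitRev_insertDigit j k m hd, digitRev_insertDigit j k m hd']
    have : 0 < w ^ k := pow_pos hw k
    gcongr
  refine skyline_eq_of_antichain ?_ ?_ ?_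
  · intro p hp
    obtain ⟨d, hd, rfl⟩ := Finset.mem_image.1 hp
    rw [Finset.mem_range] at hd
    refine Finset.mem_filter.2 ⟨mem_revSet.2 ⟨_, (hlt hd).trans_le hn, rfl⟩, ?_⟩
    rw [hpt (hlt hd)]
    refine ⟨?_, ?_⟩
    · simp only [Set.mem_Iic, Nat.cast_le]
      exact (insertDigit_strictMono hw j m).monotone (by omega)
    · simp only [Set.mem_Iic, neg_le_neg_iff, Nat.cast_le]
      rcases Nat.eq_zero_or_pos d with rfl | h0
      · exact le_rfl
      · exact (hmono hw hd h0).le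
  · intro p hp q hq hpq
    obtain ⟨d, hd, rfl⟩ := Finset.mem_image.1 hp
    obtain ⟨d', hd', rfl⟩ := Finset.mem_image.1 hq
    rw [Finset.mem_range] at hd hd'
    obtain ⟨hne, h1, h2⟩ := hpq
    rw [hpt (hlt hd), hpt (hlt hd')] at h1 h2
    simp only [Nat.cast_le, neg_le_neg_iff] at h1 h2
    rcases lt_trichotomy d d' with h | rfl | h
    · exact absurd h1 (not_le.2 (insertDigit_strictMono hw j m h))
    · exact hne rfl
    · exact absurd h2 (not_le.2 (hmono hd' hd h))
  · intro q hq hqA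
    obtain ⟨hq, hqr⟩ := Finset.mem_filter.1 hq
    obtain ⟨i, -, rfl⟩ := mem_revSet.1 hq
    -- The bound on `x` also excludes the padding points.
    have hi : i ≤ insertDigit w j m (w - 1) := by
      have := hqr.1
      simpa [revPoint] using this
    have hi' : i < w ^ (j + (1 + k)) := hi.trans_lt (hlt (by omega))
    have hr : digitRev w (j + (1 + k)) (insertDigit w j m 0) ≤ digitRev w (j + (1 + k)) i := by
      have := hqr.2
      rw [hpt hi'] at this
      simpa using this
    obtain ⟨d, hd, h1, h2⟩ := exists_insertDigit_dominates hw hi hr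
    have hmem : revPoint w (j + (1 + k)) (insertDigit w j m d) ∈ digitGroup w (j + (1 + k)) j m :=
      Finset.mem_image.2 ⟨d, Finset.mem_range.2 hd, rfl⟩
    refine ⟨_, hmem, fun h => hqA (h ▸ hmem), ?_⟩
    rw [hpt hi', hpt (hlt hd)]
    exact ⟨Nat.cast_le.2 h1, neg_le_neg (Nat.cast_le.2 h2)⟩

/-- The space bound for the digit reversal set in terms of the radix and the number of digits. -/
theorem mul_le_card_of_reportsIn_revSet {w r n b e D : ℕ} {t : ℝ} (hw : 0 < w) (hn : w ^ r ≤ n)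
    {V : Type*} [Fintype V] (G : PointerStructure (revSet w r n) V)
    (hb : ∀ v, (G.next v).card ≤ b) (hD : 0 < D)
    (ht : ∀ x y : ℝ, (antiDominanceAnswer (revSet w r n) x y).card = w →
      G.ReportsIn e (antiDominanceAnswer (revSet w r n) x y) t) :
    (r * w ^ (r - 1) : ℝ) * (w - t / D - e) ≤ Fintype.card V * (((b : ℝ) + 1) ^ D) ^ 2 := by
  have h := PointerStructure.mul_le_card_of_reportsIn hb hD
    (Finset.range r ×ˢ Finset.range (w ^ (r - 1))) (fun x => digitGroup w r x.1 x.2)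
    (m := w) (t := t) (e := e) (fun x _ => by rw [card_digitGroup hw])
    (fun x _ y _ p hp q hq hpq => Prod.ext_iff.2 (digitGroup_pair_unique hp hq hpq)) (by
      rintro ⟨j, m⟩ hx
      rw [Finset.mem_product, Finset.mem_range, Finset.mem_range] at hx
      obtain ⟨hj, hm⟩ := hx
      obtain ⟨k, rfl⟩ : ∃ k, r = j + (1 + k) := ⟨r - 1 - j, by omega⟩
      rw [show j + (1 + k) - 1 = j + k by omega] at hm
      have heq := antiDominanceAnswer_revSet hw hm hn
      have := ht _ _ (heq ▸ card_digitGroup hw _ j m)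
      rwa [heq] at this)
  simpa using h

/-! ### Choice of radix and constants. -/

open Filter in
/-- Almost every number is up to a factor of 3 a power whose base is at least a given power of its
logarithm and whose exponent is as large as possible. -/
theorem eventually_exists_radix {g : ℝ} (hg : 1 ≤ g) :
    ∀ᶠ n : ℕ in atTop, ∃ w r : ℕ, 0 < w ∧ r ≠ 0 ∧ w ^ r ≤ n ∧ (n : ℝ) ≤ 3 * (w : ℝ) ^ r ∧
      Real.log n ^ g ≤ w + 1 ∧ Real.log n / Real.log (Real.log n) ≤ 2 * g * r := by
  have hlog : Tendsto (fun n : ℕ => Real.log n) atTop atTop :=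
    Real.tendsto_log_atTop.comp tendsto_natCast_atTop_atTop
  have hll : ∀ᶠ x : ℝ in atTop, g * Real.log x ≤ x := by
    have := Real.isLittleO_log_id_atTop.bound (show (0 : ℝ) < g⁻¹ by positivity)
    filter_upwards [this, eventually_ge_atTop 1] with x hx hx1
    rw [Real.norm_of_nonneg (Real.log_nonneg hx1), id, Real.norm_of_nonneg (by linarith)] at hx
    rwa [inv_mul_eq_div, le_div_iff₀' (by linarith)] at hx
  filter_upwards [hlog.eventually hll, hlog.eventually (eventually_ge_atTop (Real.exp 1)),
    eventually_gt_atTop 0] with n hn1 hn2 hn0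
  set L := Real.log n
  have hL0 : 0 < L := (Real.exp_pos 1).trans_le hn2
  have hL1 : 1 ≤ L := (Real.one_le_exp zero_le_one).trans hn2
  have hl1 : 1 ≤ Real.log L := (Real.le_log_iff_exp_le hL0).2 hn2
  have hgl : 0 < g * Real.log L := by positivity
  have hn0' : (0 : ℝ) < n := by exact_mod_cast hn0
  have hq : 1 ≤ L / (g * Real.log L) := (one_le_div hgl).2 hn1
  set r := ⌊L / (g * Real.log L)⌋₊
  have hr1 : 1 ≤ r := Nat.one_le_floor_iff _ |>.2 hq
  have hr1' : (1 : ℝ) ≤ r := by exact_mod_cast hr1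
  have hrle : (r : ℝ) ≤ L / (g * Real.log L) := Nat.floor_le (by linarith)
  have hrlt : L / (g * Real.log L) < r + 1 := Nat.lt_floor_add_one _
  set x := (n : ℝ) ^ (r : ℝ)⁻¹
  have hx0 : 0 ≤ x := Real.rpow_nonneg hn0'.le _
  have hxr : x ^ r = n := Real.rpow_inv_natCast_pow hn0'.le (by omega)
  have hxL : L ^ g ≤ x := by
    rw [Real.rpow_def_of_pos hL0, show x = _ from Real.rpow_def_of_pos hn0' _, Real.exp_le_exp,
      ← div_eq_mul_inv, le_div_iff₀ (by linarith), mul_comm (Real.log L)]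
    rwa [le_div_iff₀ hgl, mul_comm] at hrle
  have hLg : L ≤ L ^ g := by simpa using Real.rpow_le_rpow_of_exponent_le hL1 hg
  -- Here `x = n ^ (1 / r)`; the choice of `r` gives `x ≥ L ^ g`.
  set w := ⌊x⌋₊
  have hwle : (w : ℝ) ≤ x := Nat.floor_le hx0
  have hwlt : x < w + 1 := Nat.lt_floor_add_one _
  -- This makes the loss from rounding `x` down at most `(1 + 1 / w) ^ r ≤ exp 1 < 3`.
  have hrw : r ≤ w := by
    refine Nat.le_floor ?_
    refine hrle.trans ((div_le_self hL0.le ?_).trans (hLg.trans hxL))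
    nlinarith
  have hw : 0 < w := by omega
  have hw' : (0 : ℝ) < w := by exact_mod_cast hw
  refine ⟨w, r, hw, by omega, ?_, ?_, hxL.trans hwlt.le, ?_⟩
  · have : (w : ℝ) ^ r ≤ n := hxr ▸ pow_le_pow_left₀ hw'.le hwle r
    exact_mod_cast this
  · have h1 : (w : ℝ) + 1 ≤ w * Real.exp (1 / w) := by
      have := mul_le_mul_of_nonneg_left (Real.add_one_le_exp (1 / (w : ℝ))) hw'.le
      rwa [mul_add, mul_one_div_cancel hw'.ne', mul_one, add_comm] at this
    calc (n : ℝ) = x ^ r := hxr.symm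
      _ ≤ (w * Real.exp (1 / w)) ^ r := pow_le_pow_left₀ hx0 (hwlt.le.trans h1) r
      _ = Real.exp (r * (1 / w)) * w ^ r := by rw [mul_pow, Real.exp_nat_mul, mul_comm]
      _ ≤ 3 * w ^ r := by
        refine mul_le_mul_of_nonneg_right ?_ (by positivity)
        refine (Real.exp_le_exp.2 ?_).trans (Real.exp_one_lt_d9.le.trans (by norm_num))
        rw [mul_one_div, div_le_one hw']
        exact_mod_cast hrw
  · have h1 : L / Real.log L = g * (L / (g * Real.log L)) := by
      field_simp
    rw [h1]
    have h2 : L / (g * Real.log L) ≤ 2 * r := by linarith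
    have := mul_le_mul_of_nonneg_left h2 (by linarith : 0 ≤ g)
    linarith

end RangeSkyline

/-- Space (the number of nodes) of pointer machine structures of out-degree at most `b` that answer
every anti-dominance query in time at most `C * (log^γ n + k)`, where `k` is the output size. -/
theorem mainTheorem8 (γ C : ℝ) (b e : ℕ) :
    ∃ c : ℝ, 0 < c ∧ ∃ N : ℕ, ∀ n : ℕ, N ≤ n →
      ∃ P : Finset (ℝ × ℝ), P.card = n ∧ RangeSkyline.GeneralPosition P ∧
        ∀ (V : Type) [Fintype V] (G : RangeSkyline.PointerStructure P V),
          (∀ v : V, (G.next v).card ≤ b) →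
          (∀ x y : ℝ, G.ReportsIn e (RangeSkyline.antiDominanceAnswer P x y)
            (C * (Real.log n ^ γ + ((RangeSkyline.antiDominanceAnswer P x y).card : ℝ)))) →
          c * (n * Real.log n / Real.log (Real.log n)) ≤ (Fintype.card V : ℝ) := by
  set g := max γ 1
  have hg : 1 ≤ g := le_max_right _ _
  have hg0 : 0 < g := by linarith
  set C' := max C 0
  have hC' : 0 ≤ C' := le_max_right _ _
  set D := ⌈12 * C'⌉₊ + 1
  have hD : 0 < D := Nat.succ_pos _
  have hDC : 12 * C' ≤ D := (Nat.le_ceil _).trans (by exact_mod_cast Nat.le_succ _)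
  set B : ℝ := (((b : ℝ) + 1) ^ D) ^ 2
  have hB : 0 < B := by positivity
  have hlog : Filter.Tendsto (fun n : ℕ => Real.log n) Filter.atTop Filter.atTop :=
    Real.tendsto_log_atTop.comp tendsto_natCast_atTop_atTop
  obtain ⟨N, hN⟩ := Filter.eventually_atTop.1 ((RangeSkyline.eventually_exists_radix hg).and
    (hlog.eventually (Filter.eventually_ge_atTop (4 * e + 1 : ℝ))))
  refine ⟨1 / (12 * g * B), by positivity, N, fun n hn => ?_⟩
  obtain ⟨⟨w, r, hw, hr0, hwn, hnw, hwg, hr⟩, hLe⟩ := hN n hn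
  refine ⟨RangeSkyline.revSet w r n, RangeSkyline.card_revSet w r n,
    RangeSkyline.generalPosition_revSet hw r n, fun V _ G hb ht => ?_⟩
  have hL1 : 1 ≤ Real.log n := le_trans (by simp) hLe
  have hw1 : (1 : ℝ) ≤ w := by exact_mod_cast hw
  have hLw : Real.log n ≤ w + 1 :=
    le_trans (by simpa using Real.rpow_le_rpow_of_exponent_le hL1 hg) hwg
  have hγ : Real.log n ^ γ ≤ w + 1 :=
    (Real.rpow_le_rpow_of_exponent_le hL1 (le_max_left γ 1)).trans hwg
  have h := RangeSkyline.mul_le_card_of_reportsIn_revSet (t := 3 * C' * w) hw hwn G hb hD (by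
    intro x y hxy
    obtain ⟨s, l, h1, h2, h3, h4, h5⟩ := ht x y
    refine ⟨s, l, h1, h2, h3, h4.trans ?_, h5⟩
    rw [hxy]
    have h6 : 0 ≤ Real.log n ^ γ + (w : ℝ) := by positivity
    calc C * (Real.log n ^ γ + (w : ℝ)) ≤ C' * (Real.log n ^ γ + w) :=
          mul_le_mul_of_nonneg_right (le_max_left _ _) h6
      _ ≤ C' * (3 * w) := mul_le_mul_of_nonneg_left (by linarith) hC'
      _ = 3 * C' * w := by ring)
  have hDpos : (0 : ℝ) < D := by exact_mod_cast hD
  have htD : 3 * C' * w / D ≤ w / 4 := by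
    rw [div_le_iff₀ hDpos]
    nlinarith
  have hhalf : (w : ℝ) / 2 ≤ w - 3 * C' * w / D - e := by linarith
  have hmain : (r : ℝ) * w ^ r ≤ 2 * (Fintype.card V * B) := by
    have h1 := (mul_le_mul_of_nonneg_left hhalf
      (by positivity : (0 : ℝ) ≤ r * (w : ℝ) ^ (r - 1))).trans h
    have h2 : (w : ℝ) ^ r = w ^ (r - 1) * w := (pow_sub_one_mul hr0 _).symm
    rw [h2]
    linarith
  have hll : 0 ≤ Real.log n / Real.log (Real.log n) :=
    div_nonneg (by linarith) (Real.log_nonneg hL1)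
  rw [one_div_mul_eq_div, div_le_iff₀ (by positivity), mul_div_assoc]
  calc (n : ℝ) * (Real.log n / Real.log (Real.log n)) ≤ (3 * w ^ r) * (2 * g * r) :=
        mul_le_mul hnw hr hll (by positivity)
    _ = 6 * g * (r * w ^ r) := by ring
    _ ≤ 6 * g * (2 * (Fintype.card V * B)) := mul_le_mul_of_nonneg_left hmain (by positivity)
    _ = _ := by ring
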